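/- Let $K$ be a field and $n\ge 0$. A representation of a poset $P$ is a functor from $P$ (viewed as a category) to the category of finite-dimensional $K$-vector spaces; its support is the set of points of $P$ at which it is nonzero, and it is indecomposable if it is nonzero and, whenever it is isomorphic to $W\oplus W'$, one of $W,W'$ is zero. A 1D persistence module is a representation of $\{0<1<\dots<n-1\}$ for some $n$, regarded as a representation of $\mathbb Z$ by putting zero outside $\{0,\dots,n-1\}$; a 2D persistence module is a representation of $\mathbb Z\times\mathbb Z$ with the product order. A line is a functor (order-preserving map) $L:\mathbb Z\to\mathbb Z\times\mathbb Z$ that is injective, and $V$ is a line restriction of $M$ if $M\circ L\cong V$ as representations of $\mathbb Z$ for some line $L$. Theorem. For every 1D persistence module $V$ (a representation of $\{0<1<\dots<n-1\}$) there is an indecomposable 2D persistence module $M$ with finite support such that $V$ is a line restriction of $M$. -/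

import Mathlib

open CategoryTheory CategoryTheory.Limits

universe u

noncomputable section

/-- `PosetRep K P` is the category `[P, vect_K]` of functors from the poset category `P` to the category
of finite-dimensional `K`-vector spaces; morphisms are natural transformations. -/
abbrev PosetRep (K : Type u) [Field K] (P : Type) [PartialOrder P] : Type _ :=
  P ⥤ FGModuleCat.{u} K

/-- The set of points at which a representation is nonzero. -/
def PosetRep.support {K : Type u} [Field K] {P : Type} [PartialOrder P] (V : PosetRep K P) : Set P :=
  {p | ¬ IsZero (V.obj p)}

/-- The grid `ℤ × ℤ` with the product order. (A separate name, so that its category structure is the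
poset category.) -/
def Grid : Type := ℤ × ℤ

instance : PartialOrder Grid := inferInstanceAs (PartialOrder (ℤ × ℤ))

/-- A line: a functor from the poset category `ℤ` to the poset category `ℤ × ℤ` which is injective
on objects. -/
structure Line where
  toFunctor : ℤ ⥤ Grid
  injective_obj : Function.Injective toFunctor.obj

/-- The functor `R_L : rep (ℤ × ℤ) ⥤ rep ℤ` of precomposition with a line `L`. -/
def Line.restriction (K : Type u) [Field K] (L : Line) : PosetRep K Grid ⥤ PosetRep K ℤ :=
  (Functor.whiskeringLeft ℤ Grid (FGModuleCat.{u} K)).obj L.toFunctor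

/-- `i : ℤ` lies in `[n] = {0, …, n - 1}`. -/
def InRange (n : ℕ) (i : ℤ) : Prop := 0 ≤ i ∧ i < n

instance (n : ℕ) (i : ℤ) : Decidable (InRange n i) := inferInstanceAs (Decidable (_ ∧ _))

/-- An integer in `{0, …, n - 1}` as an element of `Fin n`. -/
def InRange.toFin {n : ℕ} {i : ℤ} (h : InRange n i) : Fin n :=
  ⟨i.toNat, by have := h.1; have := h.2; omega⟩

theorem InRange.toFin_le {n : ℕ} {i j : ℤ} (hi : InRange n i) (hj : InRange n j) (hij : i ≤ j) :
    hi.toFin ≤ hj.toFin :=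
  Int.toNat_le_toNat hij

/-- The vector space at `i : ℤ` of the extension by zero of `V`. -/
def extendObj {K : Type u} [Field K] {n : ℕ} (V : PosetRep K (Fin n)) (i : ℤ) : FGModuleCat.{u} K :=
  if h : InRange n i then V.obj h.toFin else FGModuleCat.of K PUnit

theorem extendObj_eq {K : Type u} [Field K] {n : ℕ} (V : PosetRep K (Fin n)) {i : ℤ}
    (h : InRange n i) : extendObj V i = V.obj h.toFin :=
  dif_pos h

/-- The linear map along `i ≤ j` of the extension by zero of `V`: the one of `V` if both `i` and `j`
lie in `{0, …, n - 1}`, and zero otherwise. -/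
def extendMap {K : Type u} [Field K] {n : ℕ} (V : PosetRep K (Fin n)) {i j : ℤ} (hij : i ≤ j) :
    extendObj V i ⟶ extendObj V j :=
  if h : InRange n i ∧ InRange n j then
    eqToHom (extendObj_eq V h.1) ≫ V.map (homOfLE (h.1.toFin_le h.2 hij)) ≫
      eqToHom (extendObj_eq V h.2).symm
  else 0

theorem isZero_extendObj {K : Type u} [Field K] {n : ℕ} (V : PosetRep K (Fin n)) {i : ℤ}
    (h : ¬ InRange n i) : IsZero (extendObj V i) := by
  have e : extendObj V i = FGModuleCat.of K PUnit := dif_neg h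
  rw [e, IsZero.iff_id_eq_zero]
  ext x

/-- The inclusion `rep [n] ⊂ rep ℤ` on objects: a representation of `{0 < 1 < ⋯ < n - 1}`, regarded
as a representation of `ℤ` that is zero outside `{0, …, n - 1}`. -/
def extendByZero {K : Type u} [Field K] {n : ℕ} (V : PosetRep K (Fin n)) : PosetRep K ℤ where
  obj := extendObj V
  map f := extendMap V (leOfHom f)
  map_id i := by
    by_cases h : InRange n i
    · simp [extendMap, h]
    · exact (isZero_extendObj V h).eq_of_src _ _
  map_comp {i j k} f g := by
    by_cases hi : InRange n i
    · by_cases hk : InRange n k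
      · have hj : InRange n j := ⟨hi.1.trans (leOfHom f), (leOfHom g).trans_lt hk.2⟩
        have e : homOfLE (hi.toFin_le hk (leOfHom (f ≫ g))) =
            homOfLE (hi.toFin_le hj (leOfHom f)) ≫ homOfLE (hj.toFin_le hk (leOfHom g)) :=
          Subsingleton.elim _ _
        simp only [extendMap, hi, hj, hk, and_self, dif_pos, e, Functor.map_comp, Category.assoc,
          eqToHom_trans_assoc, eqToHom_refl, Category.id_comp]
      · exact (isZero_extendObj V hk).eq_of_tgt _ _
    · exact (isZero_extendObj V hi).eq_of_src _ _

/-- `V ∈ rep [n] ⊂ rep ℤ` is a line restriction of `M ∈ rep (ℤ × ℤ)` if `R_L(M) ≅ V` in `rep ℤ` for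
some line `L`. -/
def IsLineRestriction {K : Type u} [Field K] {n : ℕ} (V : PosetRep K (Fin n)) (M : PosetRep K Grid) : Prop :=
  ∃ L : Line, Nonempty ((L.restriction K).obj M ≅ extendByZero V)

end

/-! Let `W` be the extension by zero of `V`, let `d ≥ 1` bound its dimensions, and let `E = K^m`
have as basis `d` generators for each point of `{0, …, n - 1}` and one extra vector. The module `M`
consists of subquotients of `E`: a rigid part in rows `y ≤ 0`, and a presentation of `W` in row `y =
1`.

At `c = (apex, 0)` stands `E` itself. Row `y = 0` reaches `c` through the full coordinate flag, the
column below `c` through the opposite flag, and `(apex - 1, -1)` carries the line spanned by `(1, …,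
1)`. An endomorphism of `M` is at `c` a map of `E` preserving both flags, hence diagonal, and that
line, hence scalar (`exists_eq_smul_of_preserves_flags`). Up to column `apex`, row `y = 1` is a
quotient of row `y = 0`, so the scalar persists; all else is zero. Thus `End M = K`.

In row `y = 1`, at `x = (i + 1) * d`, the generators of the points up to `i` are divided by the
relations between their images in `W i`, which leaves `W i` (`restrictionIso`). -/

/-- A nonzero object all of whose endomorphisms are scalars is indecomposable. -/
theorem indecomposable_of_forall_end_eq_smul (K : Type*) [Field K] {C : Type*} [Category C]
    [Preadditive C] [Linear K C] [HasBinaryBiproducts C] {X : C} (hX : ¬ IsZero X)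
    (h : ∀ f : X ⟶ X, ∃ a : K, f = a • 𝟙 X) : Indecomposable X := by
  refine ⟨hX, fun Y Z e => ?_⟩
  -- If the projection onto `Y` is the scalar `a`, then `a` acts as `1` on `Y` and as `0` on `Z`.
  obtain ⟨a, ha⟩ := h (e.hom ≫ biprod.fst ≫ biprod.inl ≫ e.inv)
  have hY : 𝟙 Y = a • 𝟙 Y := by
    calc 𝟙 Y = biprod.inl ≫ e.inv ≫ (e.hom ≫ biprod.fst ≫ biprod.inl ≫ e.inv) ≫
          e.hom ≫ biprod.fst := by simp
      _ = a • 𝟙 Y := by rw [ha]; simp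
  have hZ : a • 𝟙 Z = 0 := by
    calc a • 𝟙 Z = biprod.inr ≫ e.inv ≫ (a • 𝟙 X) ≫ e.hom ≫ biprod.snd := by simp
      _ = 0 := by rw [← ha]; simp
  by_cases h0 : a = 0
  · left
    rw [IsZero.iff_id_eq_zero, hY, h0, zero_smul]
  · right
    rw [IsZero.iff_id_eq_zero]
    exact (smul_eq_zero_iff_right h0).mp hZ

/-! ### Representations by subquotients of a fixed space -/

section Subquotient

variable {K : Type u} [Field K] {E : Type u} [AddCommGroup E] [Module K E] [Module.Finite K E]
  {P : Type} [PartialOrder P]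

/-- The subquotient `S / (S ⊓ T)` of a vector space. -/
abbrev Subquotient (S T : Submodule K E) : Type u := S ⧸ T.submoduleOf S

/-- The map of subquotients induced by inclusions. -/
def Subquotient.map {S T S' T' : Submodule K E} (hS : S ≤ S') (hT : T ≤ T') :
    Subquotient S T →ₗ[K] Subquotient S' T' :=
  Submodule.mapQ _ _ (Submodule.inclusion hS) fun _ hx => hT hx

/-- The representation with subquotients of a fixed vector space, given by two increasing families
of subspaces. -/
noncomputable def subquotientRep (S T : P →o Submodule K E) : PosetRep K P where
  obj p := FGModuleCat.of K (Subquotient (S p) (T p))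
  map f := FGModuleCat.ofHom (Subquotient.map (S.monotone (leOfHom f)) (T.monotone (leOfHom f)))
  map_id p := by
    ext x
    rfl
  map_comp f g := by
    ext x
    rfl

theorem FGModuleCat.isZero_of_subsingleton (V : FGModuleCat.{u} K) [Subsingleton V] : IsZero V := by
  rw [IsZero.iff_id_eq_zero]
  ext x
  exact Subsingleton.elim (α := V) _ _

theorem FGModuleCat.subsingleton_of_isZero {V : FGModuleCat.{u} K} (h : IsZero V) :
    Subsingleton V := by
  refine subsingleton_of_forall_eq 0 fun x => ?_
  exact LinearMap.congr_fun (congrArg (fun g => g.hom.hom) ((IsZero.iff_id_eq_zero V).1 h)) x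

theorem mem_support_subquotientRep {S T : P →o Submodule K E} {p : P}
    (h : p ∈ (subquotientRep S T).support) : ∃ v ∈ S p, v ∉ T p := by
  by_contra! h'
  have : Subsingleton ((subquotientRep S T).obj p) := by
    refine ⟨fun a b => ?_⟩
    obtain ⟨a, rfl⟩ := Submodule.Quotient.mk_surjective _ a
    obtain ⟨b, rfl⟩ := Submodule.Quotient.mk_surjective _ b
    exact (Submodule.Quotient.eq _).2 (h' _ (a - b).2)
  exact h (FGModuleCat.isZero_of_subsingleton _)

/-- The value of an endomorphism of a subquotient representation at the class of `v`. -/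
noncomputable def endApply {S T : P →o Submodule K E} (f : subquotientRep S T ⟶ subquotientRep S T)
    (p : P) : Subquotient (S p) (T p) →ₗ[K] Subquotient (S p) (T p) :=
  (f.app p).hom.hom

theorem endApply_map {S T : P →o Submodule K E} (f : subquotientRep S T ⟶ subquotientRep S T)
    {p q : P} (h : p ≤ q) (x : Subquotient (S p) (T p)) :
    endApply f q (Subquotient.map (S.monotone h) (T.monotone h) x) =
      Subquotient.map (S.monotone h) (T.monotone h) (endApply f p x) :=
  LinearMap.congr_fun (congrArg (fun g => g.hom.hom) (f.naturality (homOfLE h))) x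

/-- An endomorphism of a subquotient representation is induced, below a point where the subquotient
is the whole space, by an endomorphism of that space. -/
theorem exists_end_of_subquotientRep {S T : P →o Submodule K E}
    (f : subquotientRep S T ⟶ subquotientRep S T) {c : P} (hS : S c = ⊤) (hT : T c = ⊥) :
    ∃ A : E →ₗ[K] E, ∀ p ≤ c, ∀ v : S p, ∃ w : S p, (w : E) = A v ∧
      endApply f p (Submodule.Quotient.mk v) = Submodule.Quotient.mk w := by
  have hbij : Function.Bijective ((T c).submoduleOf (S c)).mkQ := by
    refine ⟨?_, Submodule.mkQ_surjective _⟩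
    rw [← LinearMap.ker_eq_bot, Submodule.ker_mkQ, hT]
    simp [Submodule.submoduleOf]
  let e : E ≃ₗ[K] Subquotient (S c) (T c) :=
    (LinearEquiv.ofTop _ hS).symm.trans (LinearEquiv.ofBijective _ hbij)
  have he : ∀ v : S c, e v = Submodule.Quotient.mk v := fun v => rfl
  refine ⟨e.symm.toLinearMap ∘ₗ endApply f c ∘ₗ e.toLinearMap, fun p hp v => ?_⟩
  obtain ⟨w, hw⟩ := Submodule.Quotient.mk_surjective _ (endApply f p (Submodule.Quotient.mk v))
  refine ⟨w, ?_, hw.symm⟩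
  -- Since `T c = ⊥`, the map to `c` remembers the representative `w` itself, so naturality forces
  -- `w = A v`.
  have h := endApply_map f hp (Submodule.Quotient.mk v)
  rw [← hw] at h
  apply e.injective
  simp only [LinearMap.comp_apply, LinearEquiv.coe_coe, LinearEquiv.apply_symm_apply]
  exact (he (Submodule.inclusion (S.monotone hp) w)).trans
    (h.symm.trans (congrArg _ (he (Submodule.inclusion (S.monotone hp) v)).symm))

theorem eq_smul_id_of_endApply {S T : P →o Submodule K E}
    (f : subquotientRep S T ⟶ subquotientRep S T) (a : K)
    (h : ∀ p, ∀ v : S p, endApply f p (Submodule.Quotient.mk v) = a • Submodule.Quotient.mk v) :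
    f = a • 𝟙 (subquotientRep S T) := by
  ext p x
  obtain ⟨v, rfl⟩ := Submodule.Quotient.mk_surjective _ x
  exact h p v

/-- A linear map that is onto on `S` and whose kernel on `S` is `T` identifies the subquotient with its
target. -/
noncomputable def Subquotient.equiv {S T : Submodule K E} {W : Type u} [AddCommGroup W] [Module K W]
    (φ : E →ₗ[K] W) (hT : ∀ v ∈ S, v ∈ T ↔ φ v = 0) (hφ : ∀ w, ∃ v ∈ S, φ v = w) :
    Subquotient S T ≃ₗ[K] W :=
  LinearEquiv.ofBijective
    ((T.submoduleOf S).liftQ (φ ∘ₗ S.subtype) fun v hv => (hT v v.2).1 hv) <| by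
    constructor
    · rw [injective_iff_map_eq_zero]
      intro x hx
      obtain ⟨v, rfl⟩ := Submodule.Quotient.mk_surjective _ x
      exact (Submodule.Quotient.mk_eq_zero _).2 ((hT v v.2).2 hx)
    · intro w
      obtain ⟨v, hv, rfl⟩ := hφ w
      exact ⟨Submodule.Quotient.mk ⟨v, hv⟩, rfl⟩

end Subquotient

/-! ### Opposite flags and rigidity -/

section Flags

variable (K : Type u) [Field K] (m : ℕ)

/-- The vectors whose coordinates from `x` on vanish. -/
def lowerFlag (x : ℤ) : Submodule K (Fin m → K) where
  carrier := {v | ∀ k : Fin m, x ≤ (k : ℤ) → v k = 0}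
  add_mem' ha hb k hk := by simp [ha k hk, hb k hk]
  zero_mem' _ _ := rfl
  smul_mem' c v hv k hk := by simp [hv k hk]

/-- The vectors whose coordinates before `x` vanish. -/
def upperFlag (x : ℤ) : Submodule K (Fin m → K) where
  carrier := {v | ∀ k : Fin m, (k : ℤ) < x → v k = 0}
  add_mem' ha hb k hk := by simp [ha k hk, hb k hk]
  zero_mem' _ _ := rfl
  smul_mem' c v hv k hk := by simp [hv k hk]

variable {K m}

theorem lowerFlag_mono {x y : ℤ} (h : x ≤ y) : lowerFlag K m x ≤ lowerFlag K m y :=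
  fun _ hv k hk => hv k (h.trans hk)

theorem upperFlag_anti {x y : ℤ} (h : x ≤ y) : upperFlag K m y ≤ upperFlag K m x :=
  fun _ hv k hk => hv k (hk.trans_le h)

theorem lowerFlag_eq_top {x : ℤ} (h : (m : ℤ) ≤ x) : lowerFlag K m x = ⊤ :=
  eq_top_iff.2 fun v _ k hk => by have := k.2; omega

theorem lowerFlag_eq_bot {x : ℤ} (h : x ≤ 0) : lowerFlag K m x = ⊥ :=
  eq_bot_iff.2 fun v hv => funext fun k => hv k (by omega)

theorem upperFlag_eq_top {x : ℤ} (h : x ≤ 0) : upperFlag K m x = ⊤ :=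
  eq_top_iff.2 fun v _ k hk => by omega

theorem upperFlag_eq_bot {x : ℤ} (h : (m : ℤ) ≤ x) : upperFlag K m x = ⊥ :=
  eq_bot_iff.2 fun v hv => funext fun k => hv k (by have := k.2; omega)

/-- An endomorphism that preserves two opposite full flags and a line in general position is a
scalar. -/
theorem exists_eq_smul_of_preserves_flags (A : (Fin m → K) →ₗ[K] (Fin m → K))
    (hF : ∀ x, ∀ v ∈ lowerFlag K m x, A v ∈ lowerFlag K m x)
    (hG : ∀ x : ℕ, ∀ v ∈ upperFlag K m x, A v ∈ upperFlag K m x)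
    (hD : A 1 ∈ Submodule.span K {(1 : Fin m → K)}) : ∃ a : K, ∀ v, A v = a • v := by
  obtain ⟨a, ha⟩ := Submodule.mem_span_singleton.1 hD
  -- The upper flag kills the matrix entries with `l < k`, the lower flag those with `k < l`: `A` is
  -- diagonal.
  have hoff : ∀ k l : Fin m, l ≠ k → A (Pi.single k 1) l = 0 := by
    intro k l hlk
    rcases lt_or_gt_of_ne hlk with h | h
    · refine hG k _ (fun j hj => Pi.single_eq_of_ne (fun e => ?_) _) l (by exact_mod_cast h)
      simp [e] at hj
    · refine hF (k + 1) _ (fun j hj => Pi.single_eq_of_ne (fun e => ?_) _) l (by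
        have : (k : ℕ) < l := h
        omega)
      simp [e] at hj
  have hsum : ∀ v : Fin m → K, ∀ l, A v l = v l * A (Pi.single l 1) l := by
    intro v l
    conv_lhs => rw [pi_eq_sum_univ' v, map_sum, Finset.sum_apply]
    rw [Finset.sum_eq_single l]
    · simp [map_smul]
    · intro k _ hk
      simp [map_smul, hoff k l hk.symm]
    · simp
  refine ⟨a, fun v => funext fun l => ?_⟩
  -- The all-ones eigenvector makes every diagonal entry equal to `a`.
  have h1 := hsum 1 l
  rw [← ha] at h1
  rw [hsum v l]
  simp only [Pi.smul_apply, Pi.one_apply, smul_eq_mul, mul_one, one_mul] at h1 ⊢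
  rw [← h1, mul_comm]

end Flags

/-! ### Generators of a representation of `ℤ` -/

section Presentation

variable {K : Type u} [Field K] (W : PosetRep K ℤ)

/-- The linear map along `i ≤ j` of a representation of `ℤ`. -/
noncomputable def PosetRep.linearMap {i j : ℤ} (h : i ≤ j) : W.obj i →ₗ[K] W.obj j :=
  (W.map (homOfLE h)).hom.hom

theorem PosetRep.linearMap_refl (i : ℤ) (x : W.obj i) : W.linearMap le_rfl x = x :=
  LinearMap.congr_fun (congrArg (fun g => g.hom.hom) (W.map_id i)) x

theorem PosetRep.linearMap_linearMap {i j k : ℤ} (h : i ≤ j) (h' : j ≤ k) (x : W.obj i) :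
    W.linearMap h' (W.linearMap h x) = W.linearMap (h.trans h') x :=
  (LinearMap.congr_fun (congrArg (fun g => g.hom.hom)
    (W.map_comp (homOfLE h) (homOfLE h'))) x).symm

variable {d : ℕ} (hd : 0 < d) (g : ∀ i : ℤ, Fin d → W.obj i)

/-- The image at `i` of the `k`-th generator: the generators `g j` at the points `j ≥ 0` are numbered
one point after the other. -/
noncomputable def generatorImage (i : ℤ) (k : ℕ) : W.obj i :=
  -- The generator is born at `k / d`; before that its image is a junk zero.
  if h : ((k / d : ℕ) : ℤ) ≤ i then W.linearMap h (g _ ⟨k % d, Nat.mod_lt _ hd⟩) else 0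

theorem generatorImage_linearMap {i j : ℤ} (hij : i ≤ j) {k : ℕ} (hk : ((k / d : ℕ) : ℤ) ≤ i) :
    W.linearMap hij (generatorImage W hd g i k) = generatorImage W hd g j k := by
  rw [generatorImage, dif_pos hk, generatorImage, dif_pos (hk.trans hij), W.linearMap_linearMap]

theorem generatorImage_self (i : ℕ) (a : Fin d) :
    generatorImage W hd g i (i * d + a) = g i a := by
  have aux : ∀ (j : ℕ) (b : Fin d) (h : (j : ℤ) ≤ i), j = i → b = a →
      W.linearMap h (g j b) = g i a := by
    rintro j b h rfl rfl
    exact W.linearMap_refl _ _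
  have h1 : (i * d + a) / d = i := by
    rw [mul_comm, Nat.mul_add_div hd, Nat.div_eq_of_lt a.2, add_zero]
  have h2 : (i * d + a) % d = a := by
    rw [mul_comm, Nat.mul_add_mod, Nat.mod_eq_of_lt a.2]
  rw [generatorImage, dif_pos (by rw [h1])]
  exact aux _ _ _ h1 (Fin.ext h2)

/-- The linear map to `W.obj i` given by the first `m` generators. -/
noncomputable def presentation (m : ℕ) (i : ℤ) : (Fin m → K) →ₗ[K] W.obj i :=
  Fintype.linearCombination K fun k : Fin m => generatorImage W hd g i k

theorem div_le_of_lt_mul {i : ℤ} {k : ℕ} (hd : 0 < d) (h : (k : ℤ) < (i + 1) * d) :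
    ((k / d : ℕ) : ℤ) ≤ i := by
  have hd' : (0 : ℤ) < d := by exact_mod_cast hd
  rw [Int.natCast_div]
  have := Int.ediv_lt_of_lt_mul hd' h
  omega

theorem presentation_linearMap {m : ℕ} {i j : ℤ} (hij : i ≤ j) {v : Fin m → K}
    (hv : v ∈ lowerFlag K m ((i + 1) * d)) :
    W.linearMap hij (presentation W hd g m i v) = presentation W hd g m j v := by
  simp only [presentation, Fintype.linearCombination_apply, map_sum, map_smul]
  refine Finset.sum_congr rfl fun k _ => ?_
  by_cases hk : (i + 1) * d ≤ (k : ℤ)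
  · rw [hv k hk, zero_smul, zero_smul]
  · rw [generatorImage_linearMap W hd g hij (div_le_of_lt_mul hd (not_le.1 hk))]

theorem presentation_surjective {m : ℕ} {i : ℕ} (hm : (i + 1) * d ≤ m)
    (hg : Submodule.span K (Set.range (g i)) = ⊤) (w : W.obj i) :
    ∃ v ∈ lowerFlag K m ((i + 1) * d), presentation W hd g m i v = w := by
  have h : (⊤ : Submodule K (W.obj (i : ℤ))) ≤
      (lowerFlag K m ((i + 1) * d)).map (presentation W hd g m i) := by
    rw [← hg, Submodule.span_le]
    rintro _ ⟨a, rfl⟩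
    have hlt : i * d + a < (i + 1) * d := by rw [add_mul, one_mul]; have := a.2; omega
    refine ⟨Pi.single ⟨i * d + a, hlt.trans_le hm⟩ 1, fun k hk => ?_, ?_⟩
    · refine Pi.single_eq_of_ne (fun e => ?_) _
      rw [e] at hk
      have hk' : (i + 1) * d ≤ i * d + a := by exact_mod_cast hk
      omega
    · rw [presentation, Fintype.linearCombination_apply_single, one_smul,
        generatorImage_self W hd g]
  exact h trivial

end Presentation

/-! ### The two-dimensional representation -/

section Construction

variable {K : Type u} [Field K] (W : PosetRep K ℤ) {d : ℕ} (hd : 0 < d)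
  (g : ∀ i : ℤ, Fin d → W.obj i) (n : ℕ)

/-- The relations of the presentation at the point `i`. -/
noncomputable def relations (m : ℕ) (i : ℤ) : Submodule K (Fin m → K) :=
  -- The kernel alone contains the generators born after `i`, so it need not increase with `i`.
  lowerFlag K m ((i + 1) * d) ⊓ LinearMap.ker (presentation W hd g m i)

theorem relations_mono (m : ℕ) {i j : ℤ} (h : i ≤ j) :
    relations W hd g m i ≤ relations W hd g m j := by
  rintro v ⟨hv, hv'⟩
  refine ⟨lowerFlag_mono (by gcongr) hv, ?_⟩
  rw [SetLike.mem_coe, LinearMap.mem_ker] at hv' ⊢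
  rw [← presentation_linearMap W hd g h hv, hv', map_zero]

/-- The number of generators: `d` at each of the points `0, …, n - 1`, and one more, which maps to
zero. -/
abbrev generatorCount (d n : ℕ) : ℕ := n * d + 1

/-- The abscissa of the point at which the representation is the whole space. -/
abbrev apex (d n : ℕ) : ℤ := (n + 2) * d

/-- Generators and their flags: on the half plane `0 ≤ y` a full flag, on `y < 0` the opposite full flag,
and the diagonal line at one point. -/
noncomputable def gridSub (K : Type u) [Field K] (d n : ℕ) (x y : ℤ) :
    Submodule K (Fin (generatorCount d n) → K) :=
  if 0 ≤ y then lowerFlag K _ x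
  -- The shift makes the flag all of `E` at `y = -1`, so that it contains the diagonal to its left.
  else if apex d n ≤ x then upperFlag K _ (-y - 1)
  else if x = apex d n - 1 ∧ y = -1 then Submodule.span K {1}
  else ⊥

/-- Relations: those of `W` on the row `y = 1`. -/
noncomputable def gridRel (x y : ℤ) : Submodule K (Fin (generatorCount d n) → K) :=
  if 2 ≤ y then ⊤
  else if y = 1 then relations W hd g _ (x / d - 1)
  else if apex d n < x then ⊤
  else ⊥

include hd in
-- Strictness makes the flag of row `y = 0` already full in column `apex - 1`, where it must contain
-- the diagonal.
theorem generatorCount_lt_apex : (generatorCount d n : ℤ) < apex d n := by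
  have : (1 : ℤ) ≤ d := by exact_mod_cast hd
  simp only [generatorCount, apex]
  push_cast
  nlinarith

include hd in
theorem gridSub_mono {x y x' y' : ℤ} (hx : x ≤ x') (hy : y ≤ y') :
    gridSub K d n x y ≤ gridSub K d n x' y' := by
  have hlt := generatorCount_lt_apex hd n
  by_cases h0 : 0 ≤ y
  · rw [gridSub, if_pos h0, gridSub, if_pos (h0.trans hy)]
    exact lowerFlag_mono hx
  by_cases hX : apex d n ≤ x
  · by_cases h0' : 0 ≤ y'
    · rw [gridSub.eq_def K d n x', if_pos h0', lowerFlag_eq_top (by omega)]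
      exact le_top
    · rw [gridSub, if_neg h0, if_pos hX, gridSub, if_neg h0', if_pos (hX.trans hx)]
      exact upperFlag_anti (by omega)
  by_cases hD : x = apex d n - 1 ∧ y = -1
  · by_cases h0' : 0 ≤ y'
    · rw [gridSub.eq_def K d n x', if_pos h0', lowerFlag_eq_top (by omega)]
      exact le_top
    · by_cases hX' : apex d n ≤ x'
      · rw [gridSub.eq_def K d n x', if_neg h0', if_pos hX', upperFlag_eq_top (by omega)]
        exact le_top
      · rw [show x' = x by omega, show y' = y by omega]
  · rw [gridSub, if_neg h0, if_neg hX, if_neg hD]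
    exact bot_le

variable {n} (hW : ∀ i : ℤ, (n : ℤ) ≤ i → IsZero (W.obj i))

include hW in
theorem relations_eq_top {i : ℤ} (h : (n : ℤ) ≤ i) : relations W hd g (generatorCount d n) i = ⊤ := by
  have : Subsingleton (W.obj i) :=
    FGModuleCat.subsingleton_of_isZero (hW i h)
  have hd' : (1 : ℤ) ≤ d := by exact_mod_cast hd
  rw [relations, lowerFlag_eq_top, Subsingleton.elim (presentation W hd g _ i) 0, LinearMap.ker_zero,
    inf_top_eq]
  simp only [generatorCount]
  push_cast
  nlinarith

include hW in
theorem relations_div_eq_top {x : ℤ} (h : (n + 1) * d ≤ x) :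
    relations W hd g (generatorCount d n) (x / d - 1) = ⊤ := by
  refine relations_eq_top W hd g hW ?_
  have := Int.le_ediv_of_mul_le (by exact_mod_cast hd) h
  omega

include hW in
theorem gridRel_mono {x y x' y' : ℤ} (hx : x ≤ x') (hy : y ≤ y') :
    gridRel W hd g n x y ≤ gridRel W hd g n x' y' := by
  have hd' : (0 : ℤ) < d := by exact_mod_cast hd
  by_cases h2 : 2 ≤ y'
  · rw [gridRel.eq_def W hd g n x', if_pos h2]
    exact le_top
  by_cases h1 : y' = 1
  · rw [gridRel.eq_def W hd g n x', if_neg h2, if_pos h1, gridRel, if_neg (by omega)]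
    split_ifs with h h3
    · exact relations_mono W hd g _ (by have := Int.ediv_le_ediv hd' hx; omega)
    · rw [relations_div_eq_top W hd g hW]
      simp only [apex] at h3
      linarith
    · exact bot_le
  · rw [gridRel, gridRel, if_neg h2, if_neg h1, if_neg (by omega), if_neg (by omega)]
    split_ifs with h3 h4
    · exact le_rfl
    · omega
    · exact bot_le
    · exact le_rfl

/-- The generators of the two-dimensional representation, as an increasing family of subspaces. -/
noncomputable def gridSubHom : Grid →o Submodule K (Fin (generatorCount d n) → K) where
  toFun p := gridSub K d n p.1 p.2
  monotone' _ _ h := gridSub_mono hd n h.1 h.2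

/-- The relations of the two-dimensional representation, as an increasing family of subspaces. -/
noncomputable def gridRelHom : Grid →o Submodule K (Fin (generatorCount d n) → K) where
  toFun p := gridRel W hd g n p.1 p.2
  monotone' _ _ h := gridRel_mono W hd g hW h.1 h.2

/-- A representation of the grid with only scalar endomorphisms and with `W` on the row `y = 1`. -/
noncomputable def gridRep : PosetRep K Grid :=
  subquotientRep (gridSubHom hd) (gridRelHom W hd g hW)

theorem finite_support_gridRep : (gridRep W hd g hW).support.Finite := by
  have hlt := generatorCount_lt_apex hd n
  have hd' : (0 : ℤ) < d := by exact_mod_cast hd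
  refine (Set.finite_Icc ((0, -generatorCount d n - 1) : ℤ × ℤ) (apex d n, 1)).subset ?_
  rintro ⟨x, y⟩ hp
  obtain ⟨v, hv, hv'⟩ := mem_support_subquotientRep hp
  change v ∈ gridSub K d n x y at hv
  change v ∉ gridRel W hd g n x y at hv'
  have hy : y ≤ 1 := by
    by_contra! h
    rw [gridRel, if_pos (by omega)] at hv'
    exact hv' trivial
  have hx : x ≤ apex d n := by
    by_contra! h
    rw [gridRel, if_neg (by omega), if_pos h, relations_div_eq_top W hd g hW, ite_self] at hv'
    · exact hv' trivial
    · simp only [apex] at h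
      linarith
  have hS : gridSub K d n x y ≠ ⊥ := by
    rintro h
    rw [h, Submodule.mem_bot] at hv
    exact hv' (hv ▸ Submodule.zero_mem _)
  rw [gridSub] at hS
  split_ifs at hS with h0 h1 h2
  · have : 0 ≤ x := by
      by_contra! h
      exact hS (lowerFlag_eq_bot h.le)
    exact ⟨⟨this, by change -(generatorCount d n : ℤ) - 1 ≤ y; omega⟩, hx, hy⟩
  · have : -y - 1 < generatorCount d n := by
      by_contra! h
      exact hS (upperFlag_eq_bot h)
    exact ⟨⟨by change 0 ≤ x; omega, by change -(generatorCount d n : ℤ) - 1 ≤ y; omega⟩, hx, hy⟩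
  · exact ⟨⟨by change 0 ≤ x; omega, by change -(generatorCount d n : ℤ) - 1 ≤ y; omega⟩, hx, hy⟩
  · exact absurd rfl hS

theorem indecomposable_gridRep : Indecomposable (gridRep W hd g hW) := by
  have hlt := generatorCount_lt_apex hd n
  let S : Grid →o _ := gridSubHom (K := K) (n := n) hd
  let T := gridRelHom W hd g hW
  let c : Grid := (apex d n, 0)
  have hSc : S c = ⊤ := by
    change gridSub K d n (apex d n) 0 = ⊤
    rw [gridSub, if_pos le_rfl, lowerFlag_eq_top hlt.le]
  have hT : ∀ x y : ℤ, x ≤ apex d n → y ≤ 0 → T (x, y) = ⊥ := by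
    intro x y hx hy
    change gridRel W hd g n x y = ⊥
    rw [gridRel, if_neg (by omega), if_neg (by omega), if_neg (by omega)]
  have hTc : T c = ⊥ := hT _ _ le_rfl le_rfl
  refine indecomposable_of_forall_end_eq_smul K (fun h0 => ?_) fun f => ?_
  · have : Subsingleton ((gridRep W hd g hW).obj c) :=
      FGModuleCat.subsingleton_of_isZero (h0.obj c)
    have h1 : (1 : Fin (generatorCount d n) → K) ∈ S c := hSc ▸ trivial
    have h2 : (Submodule.Quotient.mk ⟨1, h1⟩ : Subquotient (S c) (T c)) = 0 :=
      Subsingleton.elim (α := (gridRep W hd g hW).obj c) _ _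
    rw [Submodule.Quotient.mk_eq_zero] at h2
    change (1 : Fin (generatorCount d n) → K) ∈ T c at h2
    rw [hTc, Submodule.mem_bot] at h2
    -- The extra generator keeps `E` nonzero even when `n = 0`.
    exact one_ne_zero h2
  · obtain ⟨A, hA⟩ := exists_end_of_subquotientRep (S := S) (T := T) f hSc hTc
    have hpres : ∀ x y : ℤ, x ≤ apex d n → y ≤ 0 → ∀ v ∈ gridSub K d n x y,
        A v ∈ gridSub K d n x y := by
      intro x y hx hy v hv
      obtain ⟨w, hw, -⟩ := hA (x, y) ⟨hx, hy⟩ ⟨v, hv⟩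
      exact hw ▸ w.2
    obtain ⟨a, ha⟩ := exists_eq_smul_of_preserves_flags A
      (fun x v hv => by
        by_cases hx : x ≤ apex d n
        · have := hpres x 0 hx le_rfl v
          rw [gridSub, if_pos le_rfl] at this
          exact this hv
        · rw [lowerFlag_eq_top (by omega)]
          trivial)
      (fun x v hv => by
        have := hpres (apex d n) (-x - 1) le_rfl (by omega) v
        rw [gridSub, if_neg (by omega), if_pos le_rfl, show -(-(x : ℤ) - 1) - 1 = x by omega] at this
        exact this hv)
      (by
        have := hpres (apex d n - 1) (-1) (by omega) (by omega) 1
        rw [gridSub, if_neg (by omega), if_neg (by omega), if_pos ⟨rfl, rfl⟩] at this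
        exact this (Submodule.mem_span_singleton_self _))
    have hlow : ∀ x y : ℤ, x ≤ apex d n → y ≤ 0 → ∀ v : S (x, y),
        endApply (S := S) (T := T) f (x, y) (Submodule.Quotient.mk v) =
          a • Submodule.Quotient.mk v := by
      intro x y hx hy v
      obtain ⟨w, hw, hfw⟩ := hA (x, y) ⟨hx, hy⟩ v
      rw [hfw, ← Submodule.Quotient.mk_smul]
      congr 1
      exact Subtype.ext (hw.trans (ha _))
    have htop : ∀ p : Grid, T p = ⊤ → ∀ v : S p,
        endApply (S := S) (T := T) f p (Submodule.Quotient.mk v) =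
          a • Submodule.Quotient.mk v := by
      intro p hp v
      have : (Submodule.Quotient.mk v : Subquotient (S p) (T p)) = 0 := by
        rw [Submodule.Quotient.mk_eq_zero]
        change (v : Fin (generatorCount d n) → K) ∈ T p
        rw [hp]
        trivial
      rw [this, map_zero, smul_zero]
    refine ⟨a, eq_smul_id_of_endApply (S := S) (T := T) f a ?_⟩
    rintro ⟨x, y⟩ v
    by_cases hx : x ≤ apex d n
    · rcases lt_trichotomy y 1 with hy | rfl | hy
      · exact hlow x y hx (by omega) v
      -- Rows `0` and `1` have the same generators, so every class in row `1` lifts to row `0`.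
      · have hS : S (x, 0) = S (x, 1) := by
          change gridSub K d n x 0 = gridSub K d n x 1
          rw [gridSub, gridSub, if_pos le_rfl, if_pos zero_le_one]
        have hle : ((x, 0) : Grid) ≤ (x, 1) := ⟨le_rfl, zero_le_one⟩
        have h := endApply_map (S := S) (T := T) f hle
          (Submodule.Quotient.mk ⟨v, hS.ge v.2⟩)
        rw [hlow x 0 hx le_rfl, map_smul] at h
        exact h
      · refine htop _ ?_ v
        change gridRel W hd g n x y = ⊤
        rw [gridRel, if_pos (by omega)]
    · refine htop _ ?_ v
      change gridRel W hd g n x y = ⊤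
      rw [gridRel, if_pos (not_le.1 hx), relations_div_eq_top W hd g hW, ite_self, ite_self]
      simp only [apex] at hx
      linarith

end Construction

/-! ### Restriction to the row `y = 1` -/

/-- The line through the points of the row `y = 1` whose abscissae are the multiples of `d`. -/
def rowLine {d : ℕ} (hd : 0 < d) : Line where
  toFunctor :=
    { obj := fun i => ((i + 1) * d, 1)
      map := fun {i j} f => homOfLE (by
        have := leOfHom f
        exact ⟨by change (i + 1) * (d : ℤ) ≤ (j + 1) * d; gcongr, le_rfl⟩) }
  injective_obj i j h := by
    have h' : (i + 1) * (d : ℤ) = (j + 1) * d := congrArg Prod.fst h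
    have := mul_right_cancel₀ (by exact_mod_cast hd.ne') h'
    omega

section Restriction

variable {K : Type u} [Field K] (W : PosetRep K ℤ) {d : ℕ} (hd : 0 < d)
  (g : ∀ i : ℤ, Fin d → W.obj i) {n : ℕ} (hW : ∀ i : ℤ, (n : ℤ) ≤ i → IsZero (W.obj i))
  (hW0 : ∀ i : ℤ, i < 0 → IsZero (W.obj i))
  (hg : ∀ i, Submodule.span K (Set.range (g i)) = ⊤)

include hW hW0 hg in
theorem presentation_surjective_on_row (i : ℤ) (w : W.obj i) :
    ∃ v ∈ gridSub K d n ((i + 1) * d) 1, presentation W hd g _ i v = w := by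
  by_cases h : 0 ≤ i ∧ i < n
  · obtain ⟨j, rfl⟩ := Int.eq_ofNat_of_zero_le h.1
    rw [gridSub, if_pos zero_le_one]
    refine presentation_surjective W hd g ?_ (hg _) w
    have h2 : j + 1 ≤ n := by omega
    have := Nat.mul_le_mul_right d h2
    simp only [generatorCount]
    omega
  · have hz : IsZero (W.obj i) := by
      by_cases h0 : 0 ≤ i
      · exact hW i (by omega)
      · exact hW0 i (by omega)
    have : Subsingleton (W.obj i) :=
      FGModuleCat.subsingleton_of_isZero hz
    exact ⟨0, Submodule.zero_mem _, Subsingleton.elim _ _⟩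

/-- The restriction of `gridRep` to the row `y = 1` at the point `i`. -/
noncomputable def gridRepEquiv (i : ℤ) :
    Subquotient (gridSub K d n ((i + 1) * d) 1) (gridRel W hd g n ((i + 1) * d) 1) ≃ₗ[K] W.obj i :=
  Subquotient.equiv (presentation W hd g _ i)
    (fun v hv => by
      have hd' : (d : ℤ) ≠ 0 := by exact_mod_cast hd.ne'
      rw [gridSub, if_pos zero_le_one] at hv
      rw [gridRel, if_neg (by omega), if_pos rfl, Int.mul_ediv_cancel _ hd', add_sub_cancel_right,
        relations, Submodule.mem_inf, LinearMap.mem_ker]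
      exact and_iff_right hv)
    (presentation_surjective_on_row W hd g hW hW0 hg i)

/-- The restriction of `gridRep` to the row `y = 1` is `W`. -/
noncomputable def restrictionIso :
    ((rowLine hd).restriction K).obj (gridRep W hd g hW) ≅ W :=
  NatIso.ofComponents
    (fun i => (gridRepEquiv W hd g hW hW0 hg i).toFGModuleCatIso)
    (fun {i j} f => by
      ext x
      obtain ⟨v, rfl⟩ := Submodule.Quotient.mk_surjective _ x
      have hv : (v : Fin (generatorCount d n) → K) ∈ gridSub K d n ((i + 1) * d) 1 := v.2
      rw [gridSub, if_pos zero_le_one] at hv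
      exact (presentation_linearMap W hd g (leOfHom f) hv).symm)

end Restriction

/-- A space of dimension at most `d` is spanned by a family of `d` vectors. -/
theorem exists_span_range_eq_top {K V : Type*} [Field K] [AddCommGroup V] [Module K V]
    [Module.Finite K V] {d : ℕ} (h : Module.finrank K V ≤ d) :
    ∃ g : Fin d → V, Submodule.span K (Set.range g) = ⊤ := by
  let b := Module.finBasis K V
  refine ⟨fun a => if ha : (a : ℕ) < Module.finrank K V then b ⟨a, ha⟩ else 0, ?_⟩
  rw [eq_top_iff, ← b.span_eq, Submodule.span_le]
  rintro _ ⟨k, rfl⟩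
  exact Submodule.subset_span ⟨⟨k, k.2.trans_le h⟩, by simp⟩

theorem theorem1 (K : Type u) [Field K] (n : ℕ) (V : PosetRep K (Fin n)) :
    ∃ M : PosetRep K Grid, Indecomposable M ∧ M.support.Finite ∧ IsLineRestriction V M := by
  let W := extendByZero V
  have hW : ∀ i : ℤ, (n : ℤ) ≤ i → IsZero (W.obj i) := fun i hi =>
    isZero_extendObj V fun h => (h.2.trans_le hi).false
  have hW0 : ∀ i : ℤ, i < 0 → IsZero (W.obj i) := fun i hi =>
    isZero_extendObj V fun h => (h.1.trans_lt hi).false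
  -- The `+ 1` keeps `d` positive even if `W = 0`; otherwise `rowLine` would not be injective.
  let d := (Finset.Ico (0 : ℤ) n).sup (fun i => Module.finrank K (W.obj i)) + 1
  have hd : 0 < d := Nat.succ_pos _
  have hrank : ∀ i, Module.finrank K (W.obj i) ≤ d := by
    intro i
    by_cases hi : i ∈ Finset.Ico (0 : ℤ) n
    · exact (Finset.le_sup (f := fun i => Module.finrank K (W.obj i)) hi).trans (Nat.le_succ _)
    · have : Subsingleton (W.obj i) :=
        FGModuleCat.subsingleton_of_isZero
          (isZero_extendObj V fun h => hi (Finset.mem_Ico.2 h))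
      rw [Module.finrank_zero_of_subsingleton]
      exact Nat.zero_le _
  choose g hg using fun i => exists_span_range_eq_top (hrank i)
  exact ⟨gridRep W hd g hW, indecomposable_gridRep W hd g hW, finite_support_gridRep W hd g hW,
    rowLine hd, ⟨restrictionIso W hd g hW hW0 hg⟩⟩
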